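/- Let $\mathbb N^{\mathbb Z}_f$ be the set of finitely supported sequences of non-negative integers indexed by $\mathbb Z$, let $e_j$ be its $j$-th unit vector and $|\alpha|=\sum_j\alpha_j$. Let $\mathcal F$ be the real vector space of formal power series $H(u)=\sum_{\alpha,\beta\in\mathbb N^{\mathbb Z}_f}H_{\alpha,\beta}\,u^\alpha\bar u^\beta$ in the variables $u=(u_j)_{j\in\mathbb Z}$, with complex coefficients, such that $H_{0,0}=H_{e_0,0}=H_{0,e_0}=0$, $H_{\alpha,\beta}=\overline{H_{\beta,\alpha}}$ for all $\alpha,\beta$, and $H_{\alpha,\beta}=0$ whenever $\pi(\alpha,\beta):=\sum_j j(\alpha_j-\beta_j)\neq0$. For $d\in\mathbb N$ let $\mathcal F^{\ge d}$ be the subspace of those $H\in\mathcal F$ with $H_{\alpha,\beta}=0$ whenever $|\alpha|+|\beta|<d+2$, and let $\Pi^{(\le d)}H=\sum_{|\alpha|+|\beta|\le d+2}H_{\alpha,\beta}u^\alpha\bar u^\beta$. The Poisson bracket on $\mathcal F$ is $$\{F,G\}=\mathrm i\sum_{\alpha^{(i)},\beta^{(i)}}F_{\alpha^{(1)},\beta^{(1)}}G_{\alpha^{(2)},\beta^{(2)}}\sum_{j\in\mathbb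 Z}\big(\alpha^{(1)}_j\beta^{(2)}_j-\beta^{(1)}_j\alpha^{(2)}_j\big)u^{\alpha^{(1)}+\alpha^{(2)}-e_j}\,\bar u^{\beta^{(1)}+\beta^{(2)}-e_j},$$ in which each coefficient is a finite sum. For $G\in\mathcal F^{\ge1}$ let $e^{\{G,\cdot\}}=\sum_{k\ge0}\frac1{k!}\,\mathrm{ad}_G^k$ with $\mathrm{ad}_G=\{G,\cdot\}$; this is a well-defined linear operator on $\mathcal F$ (each coefficient is a finite sum), called a formal symplectic change of variables. Then the following hold. 1. (Baker–Campbell–Hausdorff) If $F\in\mathcal F^{\ge d_1}$ and $G\in\mathcal F^{\ge d_2}$ with $d_1,d_2\ge1$, then there is $K\in\mathcal F^{\ge1}$ such that $$e^{\{G,\cdot\}}e^{\{F,\cdot\}}=e^{\{K,\cdot\}}\qquad\text{and}\qquad K-F-G\in\mathcal F^{\ge d_1+d_2}.$$ 2. (Infinite compositions) If $G_i\in\mathcal F^{\ge d_i}$ for $i=0,1,2,\dots$, with $1\le d_0<d_1<d_2<\cdots$, then there is $\mathcal G\in\mathcal F^{\ge d_0}$ such that $\prod_i e^{\{G_i,\cdot\}}=e^{\{\mathcal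 G,\cdot\}}$. Here $\prod_i e^{\{G_i,\cdot\}}$ is the limit of the finite compositions $P_N=e^{\{G_{N-1},\cdot\}}\cdots e^{\{G_1,\cdot\}}e^{\{G_0,\cdot\}}$ in the following sense: for every $d\in\mathbb N$ there is $N_0$ such that $\Pi^{(\le d)}P_N=\Pi^{(\le d)}e^{\{\mathcal G,\cdot\}}$ for all $N\ge N_0$. 3. (Group structure) The set of formal symplectic changes of variables $\{e^{\{G,\cdot\}}:G\in\mathcal F^{\ge1}\}$ is a group under composition, that is, a subgroup of the group of invertible linear operators on $\mathcal F$. -/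

import Mathlib

open scoped Nat ComplexConjugate

noncomputable section

namespace FormalBNF

/-- Finitely supported sequences of non-negative integers indexed by `ℤ`. -/
abbrev MultiIndex := ℤ →₀ ℕ

/-- The vector with `j`-th entry `1` and all other entries `0`. -/
abbrev unitIndex (j : ℤ) : MultiIndex := Finsupp.single j 1

/-- The weighted length `∑ j, j * α j`. -/
def weight (α : MultiIndex) : ℤ := α.sum fun j n => j * (n : ℤ)

/-- The momentum `π(α, β) = ∑ j, j * (α j - β j)`. -/
def momentum (α β : MultiIndex) : ℤ := weight α - weight β

/-- The total degree `|α| + |β|` of the monomial `u ^ α * (conj u) ^ β`. -/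
def totalDegree (α β : MultiIndex) : ℕ := α.degree + β.degree

/-- The real vector space of formal Hamiltonians `∑ H (α, β) u ^ α (conj u) ^ β`, given by their
families of coefficients: no constant term and no linear term in the zeroth mode, real, momentum
conserving. -/
def FormalHam : Submodule ℝ (MultiIndex × MultiIndex → ℂ) where
  carrier := {H | H (0, 0) = 0 ∧ H (unitIndex 0, 0) = 0 ∧ H (0, unitIndex 0) = 0 ∧
    (∀ α β, H (α, β) = conj (H (β, α))) ∧
    ∀ α β, momentum α β ≠ 0 → H (α, β) = 0}
  zero_mem' := by simp
  add_mem' := by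
    rintro F G ⟨a, b, c, d, e⟩ ⟨a', b', c', d', e'⟩
    refine ⟨by simp [a, a'], by simp [b, b'], by simp [c, c'], fun α β => ?_, fun α β h => ?_⟩
    · simp only [Pi.add_apply, map_add]
      rw [← d α β, ← d' α β]
    · simp [e α β h, e' α β h]
  smul_mem' := by
    rintro r F ⟨a, b, c, d, e⟩
    refine ⟨by simp [a], by simp [b], by simp [c], fun α β => ?_, fun α β h => ?_⟩
    · simp only [Pi.smul_apply, Complex.real_smul, map_mul, Complex.conj_ofReal]
      rw [← d α β]
    · simp [e α β h]

/-- The coefficient of `u ^ α * (conj u) ^ β`. -/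
def coeff (H : FormalHam) (α β : MultiIndex) : ℂ := H.1 (α, β)

@[ext] theorem ext_coeff {F G : FormalHam} (h : ∀ α β, coeff F α β = coeff G α β) : F = G :=
  Subtype.ext (funext fun p => h p.1 p.2)

theorem coeff_add (F G : FormalHam) (α β : MultiIndex) :
    coeff (F + G) α β = coeff F α β + coeff G α β := rfl

theorem coeff_smul (r : ℝ) (F : FormalHam) (α β : MultiIndex) :
    coeff (r • F) α β = r • coeff F α β := rfl

theorem coeff_conj (F : FormalHam) (α β : MultiIndex) :
    coeff F α β = conj (coeff F β α) := F.2.2.2.2.1 α β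

theorem momentum_of_coeff_ne {F : FormalHam} {α β : MultiIndex} (h : coeff F α β ≠ 0) :
    momentum α β = 0 := by
  by_contra h'
  exact h (F.2.2.2.2.2 α β h')

theorem weight_add (α β : MultiIndex) : weight (α + β) = weight α + weight β := by
  unfold weight
  exact Finsupp.sum_add_index' (by simp) (by intros; push_cast; ring)

theorem weight_unit (j : ℤ) : weight (unitIndex j) = j := by
  simp [weight]

theorem coeff_eq_zero_of_totalDegree_lt (F : FormalHam) {α β : MultiIndex}
    (h : totalDegree α β < 2) : coeff F α β = 0 := by
  by_contra hne
  have hm := momentum_of_coeff_ne hne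
  unfold totalDegree at h
  rcases Nat.eq_zero_or_pos α.degree with ha | ha
  · rcases Nat.eq_zero_or_pos β.degree with hb | hb
    · rw [Finsupp.degree_eq_zero_iff] at ha hb
      subst ha; subst hb
      exact hne F.2.1
    · have hb1 : β.degree = 1 := by omega
      rw [Finsupp.degree_eq_zero_iff] at ha
      subst ha
      obtain ⟨j, rfl⟩ := (Finsupp.range_single_one (σ := ℤ)).ge (show β ∈ {d : ℤ →₀ ℕ | d.degree = 1} from hb1)
      have : j = 0 := by simpa [momentum, weight] using hm
      subst this
      exact hne F.2.2.2.1
  · have ha1 : α.degree = 1 := by omega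
    have hb : β.degree = 0 := by omega
    rw [Finsupp.degree_eq_zero_iff] at hb
    subst hb
    obtain ⟨j, rfl⟩ := (Finsupp.range_single_one (σ := ℤ)).ge (show α ∈ {d : ℤ →₀ ℕ | d.degree = 1} from ha1)
    have : j = 0 := by simpa [momentum, weight] using hm
    subst this
    exact hne F.2.2.1

/-- `hamGE d` consists of the formal Hamiltonians all of whose monomials have total degree at least
`d + 2`, that is, scaling degree at least `d`. -/
def hamGE (d : ℕ) : Submodule ℝ FormalHam where
  carrier := {H | ∀ α β, totalDegree α β < d + 2 → coeff H α β = 0}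
  zero_mem' := fun _ _ _ => rfl
  add_mem' := by
    intro F G hF hG α β h
    rw [coeff_add, hF α β h, hG α β h, add_zero]
  smul_mem' := by
    intro r F hF α β h
    rw [coeff_smul, hF α β h, smul_zero]

/-- The projection of a formal Hamiltonian on its part of scaling degree at most `d`. -/
def projLE (d : ℕ) : FormalHam →ₗ[ℝ] FormalHam where
  toFun H := ⟨fun p => if totalDegree p.1 p.2 ≤ d + 2 then coeff H p.1 p.2 else 0, by
    have hs : ∀ α β, totalDegree α β = totalDegree β α := fun α β => Nat.add_comm _ _
    refine ⟨?_, ?_, ?_, fun α β => ?_, fun α β h => ?_⟩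
    · simp [show coeff H 0 0 = 0 from H.2.1]
    · simp [show coeff H (unitIndex 0) 0 = 0 from H.2.2.1]
    · simp [show coeff H 0 (unitIndex 0) = 0 from H.2.2.2.1]
    · simp only [hs β α, coeff_conj H α β]
      split_ifs <;> simp
    · simp [show coeff H α β = 0 from H.2.2.2.2.2 α β h]⟩
  map_add' F G := by
    ext α β
    simp only [coeff_add]
    simp only [coeff]
    split_ifs <;> simp
  map_smul' r F := by
    ext α β
    simp only [coeff_smul, RingHom.id_apply]
    simp only [coeff]
    split_ifs <;> simp

/-- The part of the coefficient of `u ^ α * (conj u) ^ β` in the Poisson bracket `{F, G}` (up to the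
factor `I`) that comes from differentiating with respect to `u j` and `conj (u j)`: the sum over all
`α₁ + α₂ = α + e_j` and `β₁ + β₂ = β + e_j`. -/
def bracketTerm (F G : FormalHam) (α β : MultiIndex) (j : ℤ) : ℂ :=
  ∑ p ∈ Finset.HasAntidiagonal.antidiagonal (α + unitIndex j), ∑ q ∈ Finset.HasAntidiagonal.antidiagonal (β + unitIndex j),
    coeff F p.1 q.1 * coeff G p.2 q.2 *
      ((p.1 j : ℂ) * (q.2 j : ℂ) - (q.1 j : ℂ) * (p.2 j : ℂ))

/-- The coefficient of `u ^ α * (conj u) ^ β` in the Poisson bracket `{F, G}`. The sum over `j` has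
only finitely many non-zero terms, see `finite_support_bracketTerm`. -/
def bracketCoeff (F G : FormalHam) (α β : MultiIndex) : ℂ :=
  Complex.I * ∑ᶠ j : ℤ, bracketTerm F G α β j

theorem exists_of_bracketTerm_ne {F G : FormalHam} {α β : MultiIndex} {j : ℤ}
    (h : bracketTerm F G α β j ≠ 0) :
    ∃ α₁ α₂ β₁ β₂ : MultiIndex, α₁ + α₂ = α + unitIndex j ∧ β₁ + β₂ = β + unitIndex j ∧
      coeff F α₁ β₁ ≠ 0 ∧ coeff G α₂ β₂ ≠ 0 ∧
      ((α₁ j ≠ 0 ∧ β₂ j ≠ 0) ∨ (β₁ j ≠ 0 ∧ α₂ j ≠ 0)) := by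
  obtain ⟨p, hp, h⟩ := Finset.exists_ne_zero_of_sum_ne_zero h
  obtain ⟨q, hq, h⟩ := Finset.exists_ne_zero_of_sum_ne_zero h
  refine ⟨p.1, p.2, q.1, q.2, Finset.HasAntidiagonal.mem_antidiagonal.1 hp, Finset.HasAntidiagonal.mem_antidiagonal.1 hq,
    fun h0 => h (by simp [h0]), fun h0 => h (by simp [h0]), ?_⟩
  by_contra hc
  push Not at hc
  apply h
  have e1 : (p.1 j : ℂ) * (q.2 j : ℂ) = 0 := by
    by_cases h1 : p.1 j = 0
    · simp [h1]
    · simp [hc.1 h1]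
  have e2 : (q.1 j : ℂ) * (p.2 j : ℂ) = 0 := by
    by_cases h1 : q.1 j = 0
    · simp [h1]
    · simp [hc.2 h1]
  rw [e1, e2]
  simp

/-- If `a + b = c + e_j` and the `j`-th entry of `a` is positive, then `a - e_j` is a summand of
`c`. -/
theorem exists_sub_unit {a b c : MultiIndex} {j : ℤ} (h : a + b = c + unitIndex j) (ha : a j ≠ 0) :
    ∃ a' : MultiIndex, a = a' + unitIndex j ∧ a' + b = c := by
  have hle : unitIndex j ≤ a := by
    rw [Finsupp.single_le_iff]
    omega
  obtain ⟨a', rfl⟩ := exists_add_of_le hle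
  refine ⟨a', add_comm _ _, ?_⟩
  have : (a' + b) + unitIndex j = c + unitIndex j := by rw [← h]; abel
  exact add_right_cancel this

theorem finite_support_bracketTerm (F G : FormalHam) (α β : MultiIndex) :
    (Function.support (bracketTerm F G α β)).Finite := by
  classical
  let S : Finset (MultiIndex × MultiIndex) :=
    ((Finset.HasAntidiagonal.antidiagonal α).image Prod.fst) ×ˢ ((Finset.HasAntidiagonal.antidiagonal β).image Prod.fst)
  let T : Finset ℤ := α.support ∪ β.support ∪
    (S.image (fun s => momentum s.1 s.2) ∪ S.image (fun s => - momentum s.1 s.2))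
  refine (T.finite_toSet).subset fun j hj => ?_
  obtain ⟨α₁, α₂, β₁, β₂, hα, hβ, hF, -, hor⟩ := exists_of_bracketTerm_ne hj
  have hm := momentum_of_coeff_ne hF
  simp only [T, Finset.coe_union, Set.mem_union, Finset.mem_coe, Finset.mem_image]
  rcases hor with ⟨h1, h2⟩ | ⟨h1, h2⟩
  · right; right
    obtain ⟨a, rfl, ha⟩ := exists_sub_unit hα h1
    obtain ⟨b, rfl, hb⟩ := exists_sub_unit ((add_comm β₂ β₁).trans hβ) h2
    refine ⟨(a, β₁), ?_, ?_⟩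
    · simp only [S, Finset.mem_product, Finset.mem_image, Finset.HasAntidiagonal.mem_antidiagonal]
      exact ⟨⟨(a, α₂), ha, rfl⟩, ⟨(β₁, b), by rw [add_comm]; exact hb, rfl⟩⟩
    · simp only [momentum, weight_add, weight_unit] at hm ⊢
      linarith
  · right; left
    obtain ⟨b, rfl, hb⟩ := exists_sub_unit hβ h1
    obtain ⟨a, rfl, ha⟩ := exists_sub_unit ((add_comm α₂ α₁).trans hα) h2
    refine ⟨(α₁, b), ?_, ?_⟩
    · simp only [S, Finset.mem_product, Finset.mem_image, Finset.HasAntidiagonal.mem_antidiagonal]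
      exact ⟨⟨(α₁, a), by rw [add_comm]; exact ha, rfl⟩, ⟨(b, β₂), hb, rfl⟩⟩
    · simp only [momentum, weight_add, weight_unit] at hm ⊢
      linarith

theorem exists_of_bracketCoeff_ne {F G : FormalHam} {α β : MultiIndex}
    (h : bracketCoeff F G α β ≠ 0) : ∃ j, bracketTerm F G α β j ≠ 0 := by
  by_contra hc
  push Not at hc
  apply h
  simp [bracketCoeff, hc]

theorem momentum_of_bracketCoeff_ne {F G : FormalHam} {α β : MultiIndex}
    (h : bracketCoeff F G α β ≠ 0) : momentum α β = 0 := by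
  obtain ⟨j, hj⟩ := exists_of_bracketCoeff_ne h
  obtain ⟨α₁, α₂, β₁, β₂, hα, hβ, hF, hG, -⟩ := exists_of_bracketTerm_ne hj
  have hmF := momentum_of_coeff_ne hF
  have hmG := momentum_of_coeff_ne hG
  have h1 := congrArg weight hα
  have h2 := congrArg weight hβ
  simp only [weight_add, weight_unit] at h1 h2
  unfold momentum at *
  linarith

theorem le_totalDegree_of_bracketCoeff_ne {F G : FormalHam} {d e : ℕ} (hF : F ∈ hamGE d)
    (hG : G ∈ hamGE e) {α β : MultiIndex} (h : bracketCoeff F G α β ≠ 0) :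
    d + e + 2 ≤ totalDegree α β := by
  obtain ⟨j, hj⟩ := exists_of_bracketCoeff_ne h
  obtain ⟨α₁, α₂, β₁, β₂, hα, hβ, hF', hG', -⟩ := exists_of_bracketTerm_ne hj
  have h1 : d + 2 ≤ totalDegree α₁ β₁ := by
    by_contra hc
    exact hF' (hF _ _ (by omega))
  have h2 : e + 2 ≤ totalDegree α₂ β₂ := by
    by_contra hc
    exact hG' (hG _ _ (by omega))
  have h3 := congrArg Finsupp.degree hα
  have h4 := congrArg Finsupp.degree hβ
  simp only [map_add, Finsupp.degree_single] at h3 h4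
  unfold totalDegree at *
  omega

theorem mem_hamGE_zero (F : FormalHam) : F ∈ hamGE 0 :=
  fun _ _ h => coeff_eq_zero_of_totalDegree_lt F (by omega)

theorem bracketTerm_conj (F G : FormalHam) (α β : MultiIndex) (j : ℤ) :
    conj (bracketTerm F G β α j) = - bracketTerm F G α β j := by
  unfold bracketTerm
  simp only [map_sum]
  rw [Finset.sum_comm, ← Finset.sum_neg_distrib]
  refine Finset.sum_congr rfl fun p _ => ?_
  rw [← Finset.sum_neg_distrib]
  refine Finset.sum_congr rfl fun q _ => ?_
  rw [coeff_conj F p.1 q.1, coeff_conj G p.2 q.2]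
  simp only [map_mul, map_sub, Complex.conj_natCast]
  ring

theorem bracketCoeff_conj (F G : FormalHam) (α β : MultiIndex) :
    bracketCoeff F G α β = conj (bracketCoeff F G β α) := by
  unfold bracketCoeff
  have : conj (∑ᶠ j, bracketTerm F G β α j) = - ∑ᶠ j, bracketTerm F G α β j := by
    rw [← finsum_neg_distrib]
    have := (starRingEnd ℂ).toAddMonoidHom.map_finsum (finite_support_bracketTerm F G β α)
    refine this.trans (finsum_congr fun j => ?_)
    exact bracketTerm_conj F G α β j
  rw [map_mul, this, Complex.conj_I]
  ring

/-- The Poisson bracket `{F, G}` of two formal Hamiltonians. -/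
def bracket (F G : FormalHam) : FormalHam :=
  ⟨fun p => bracketCoeff F G p.1 p.2, by
    have hlow : ∀ α β, totalDegree α β < 2 → bracketCoeff F G α β = 0 := by
      intro α β h
      by_contra hc
      have := le_totalDegree_of_bracketCoeff_ne (mem_hamGE_zero F) (mem_hamGE_zero G) hc
      omega
    refine ⟨hlow _ _ (by simp [totalDegree]), hlow _ _ (by simp [totalDegree]),
      hlow _ _ (by simp [totalDegree]), bracketCoeff_conj F G, fun α β h => ?_⟩
    by_contra hc
    exact h (momentum_of_bracketCoeff_ne hc)⟩

theorem coeff_bracket (F G : FormalHam) (α β : MultiIndex) :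
    coeff (bracket F G) α β = Complex.I * ∑ᶠ j : ℤ, bracketTerm F G α β j := rfl

theorem bracket_mem {F G : FormalHam} {d e : ℕ} (hF : F ∈ hamGE d) (hG : G ∈ hamGE e) :
    bracket F G ∈ hamGE (d + e) := by
  intro α β h
  by_contra hc
  exact absurd (le_totalDegree_of_bracketCoeff_ne hF hG hc) (not_le.2 h)

/-- The operator `ad_G = {G, ·}`. -/
def ad (G : FormalHam) : Module.End ℝ FormalHam where
  toFun H := bracket G H
  map_add' H H' := by
    ext α β
    rw [coeff_add]
    simp only [coeff_bracket]
    rw [← mul_add, ← finsum_add_distrib (finite_support_bracketTerm _ _ _ _)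
      (finite_support_bracketTerm _ _ _ _)]
    congr 1
    refine finsum_congr fun j => ?_
    simp only [bracketTerm]
    simp only [← Finset.sum_add_distrib, coeff_add]
    refine Finset.sum_congr rfl fun p _ => Finset.sum_congr rfl fun q _ => ?_
    ring
  map_smul' r H := by
    ext α β
    rw [coeff_smul]
    simp only [coeff_bracket, RingHom.id_apply, Complex.real_smul]
    rw [mul_left_comm, mul_finsum (bracketTerm G H α β) (r : ℂ)]
    congr 1
    refine finsum_congr fun j => ?_
    simp only [bracketTerm]
    simp only [Finset.mul_sum, coeff_smul, Complex.real_smul]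
    refine Finset.sum_congr rfl fun p _ => Finset.sum_congr rfl fun q _ => ?_
    ring

theorem ad_pow_mem (G : hamGE 1) (H : FormalHam) (k : ℕ) :
    ((ad (G : FormalHam)) ^ k) H ∈ hamGE k := by
  induction k with
  | zero => exact mem_hamGE_zero _
  | succ k ih =>
    rw [pow_succ', Module.End.mul_apply, add_comm]
    exact bracket_mem G.2 ih

/-- The coefficient of `u ^ α * (conj u) ^ β` in the `k`-th term `ad_G ^ k H / k!` of the exponential
series. -/
def expTerm (G : hamGE 1) (H : FormalHam) (α β : MultiIndex) (k : ℕ) : ℂ :=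
  ((k ! : ℝ)⁻¹) • coeff (((ad (G : FormalHam)) ^ k) H) α β

theorem finite_support_expTerm (G : hamGE 1) (H : FormalHam) (α β : MultiIndex) :
    (Function.support (expTerm G H α β)).Finite := by
  refine (Set.finite_le_nat (totalDegree α β)).subset fun k hk => ?_
  by_contra hc
  simp only [Set.mem_ofPred_eq, not_le] at hc
  exact hk (by rw [expTerm, ad_pow_mem G H k α β (by omega), smul_zero])

/-- The formal symplectic change of variables `exp {G, ·} = ∑ k, ad_G ^ k / k!` generated by a formal
Hamiltonian `G` of scaling degree at least one. In each coefficient the sum over `k` has only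
finitely many non-zero terms, see `finite_support_expTerm`. -/
def expAd (G : hamGE 1) : Module.End ℝ FormalHam where
  toFun H := ⟨fun p => ∑ᶠ k : ℕ, expTerm G H p.1 p.2 k, by
    have hz : ∀ α β, (∀ H' : FormalHam, coeff H' α β = 0) →
        ∑ᶠ k : ℕ, expTerm G H α β k = 0 := by
      intro α β h
      simp [expTerm, h]
    refine ⟨hz _ _ fun H' => H'.2.1, hz _ _ fun H' => H'.2.2.1, hz _ _ fun H' => H'.2.2.2.1,
      fun α β => ?_, fun α β h => hz _ _ fun H' => H'.2.2.2.2.2 α β h⟩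
    have := (starRingEnd ℂ).toAddMonoidHom.map_finsum (finite_support_expTerm G H β α)
    refine Eq.trans (finsum_congr fun k => ?_) this.symm
    change _ = conj (expTerm G H β α k)
    simp only [expTerm, Complex.real_smul, map_mul, Complex.conj_ofReal]
    rw [← coeff_conj]⟩
  map_add' H H' := by
    ext α β
    refine Eq.trans (finsum_congr fun k => ?_) (finsum_add_distrib
      (finite_support_expTerm G H α β) (finite_support_expTerm G H' α β))
    simp only [expTerm, map_add, coeff_add, smul_add]
  map_smul' r H := by
    ext α β
    refine Eq.trans (finsum_congr fun k => ?_) (smul_finsum r _).symm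
    simp only [expTerm, map_smul, coeff_smul]
    rw [smul_comm]

/-- The finite composition `L (N - 1) ∘ ⋯ ∘ L 1 ∘ L 0`: later operators are applied later. -/
def partialComp (L : ℕ → Module.End ℝ FormalHam) : ℕ → Module.End ℝ FormalHam
  | 0 => 1
  | N + 1 => L N * partialComp L N

/-- `T` is the infinite composition `⋯ ∘ L 2 ∘ L 1 ∘ L 0`: in every scaling degree the finite
compositions are eventually equal to `T`. -/
def IsInfiniteComp (L : ℕ → Module.End ℝ FormalHam) (T : Module.End ℝ FormalHam) : Prop :=
  ∀ d : ℕ, ∃ N₀ : ℕ, ∀ N ≥ N₀, projLE d * partialComp L N = projLE d * T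

end FormalBNF

end

/-!
The proof runs inside the Lie algebra of formal Hamiltonians, filtered by scaling degree, and uses
its scaling derivation `D` (`scaling`), which multiplies each monomial of total degree `n` by
`n - 2`.

*Jacobi identity.* Momentum conservation bounds, in terms of `(α, β)` alone, the modes that
contribute to the coefficient `(α, β)` of a bracket. So each coefficient of a double bracket is
computed by a bracket with finitely many modes on formal power series, where the Jacobi identity
follows from the Leibniz rule and the symmetry of second derivatives (`finPoisson_jacobi`,
`exists_coeff_bracket_bracket_eq`, `bracket_jacobi`).

*Baker–Campbell–Hausdorff without the formula.* For `K` of scaling degree at least one,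
`[D, exp {K, ·}] = {y, exp {K, ·}}` with `y = ∑ ad_K ^ p (D K) / (p + 1)!`, the logarithmic
derivative of `exp {K, ·}` along `D` (`hasLogDeriv_expAd`). Three facts carry the argument.
An operator tangent to the identity is determined by its logarithmic derivative, since commuting
with `D` means preserving the scaling degree (`HasLogDeriv.unique`). The product
`exp {G, ·} exp {F, ·}` has a logarithmic derivative too, because `exp {G, ·}` is an automorphism
of the Lie algebra (`HasLogDeriv.expAd_mul`). And every Hamiltonian of scaling degree at least one
is the logarithmic derivative of some `exp {K, ·}`: since `D` is invertible there and the terms of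
`y` with `p ≥ 1` are contracting for the filtration, `K` is found as a fixed point
(`exists_hamSum_logDerivTerm`). The same contraction property turns the estimate of logarithmic
derivatives modulo scaling degree `d₁ + d₂` into the estimate of `K - F - G`.

*Infinite compositions and group structure.* The generators of the finite compositions form a
Cauchy sequence by the estimate just mentioned, and `exp {K, ·}` depends continuously on `K`. The
inverse of `exp {G, ·}` is `exp {-G, ·}`.
-/

noncomputable section

namespace FormalBNF

/-! ### The Jacobi identity -/

section FinitePoisson

variable {ι R : Type*} [CommRing R]

/-- The Poisson bracket `∑ j ∈ J, (D j f * D' j g - D' j f * D j g)` attached to a finite set of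
pairs of additive maps `D j`, `D' j` on a commutative ring; it is meant for derivations. -/
def finPoisson (D D' : ι → R →+ R) (J : Finset ι) (f g : R) : R :=
  ∑ j ∈ J, (D j f * D' j g - D' j f * D j g)

theorem finPoisson_jacobi [IsAddTorsionFree R] (D D' : ι → R →+ R)
    (hm : ∀ i f g, D i (f * g) = f * D i g + D i f * g)
    (hm' : ∀ i f g, D' i (f * g) = f * D' i g + D' i f * g)
    (hD : ∀ i j f, D i (D j f) = D j (D i f)) (hD' : ∀ i j f, D' i (D' j f) = D' j (D' i f))
    (hDD' : ∀ i j f, D' i (D j f) = D j (D' i f)) (J : Finset ι) (f g h : R) :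
    finPoisson D D' J f (finPoisson D D' J g h) + finPoisson D D' J g (finPoisson D D' J h f) +
      finPoisson D D' J h (finPoisson D D' J f g) = 0 := by
  -- The double sum equals its own opposite: exchanging the two summation indices changes its sign.
  refine self_eq_neg.1 ?_
  simp only [finPoisson, map_sum, Finset.mul_sum, ← Finset.sum_sub_distrib,
    ← Finset.sum_add_distrib, ← Finset.sum_neg_distrib]
  nth_rewrite 1 [Finset.sum_comm]
  refine Finset.sum_congr rfl fun j _ => Finset.sum_congr rfl fun k _ => ?_
  simp only [map_sub, hm, hm', hDD']
  rw [hD k j f, hD k j g, hD k j h, hD' k j f, hD' k j g, hD' k j h]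
  ring

end FinitePoisson

/-- Formal power series in the variables `u j` with coefficients in the formal power series in the
variables `conj (u j)`, all treated as independent. -/
abbrev Series := MvPowerSeries ℤ (MvPowerSeries ℤ ℂ)

/-- The coefficient of `u ^ α * (conj u) ^ β`. -/
def sCoeff (α β : MultiIndex) (f : Series) : ℂ := MvPowerSeries.coeff β (MvPowerSeries.coeff α f)

theorem sCoeff_ext {f g : Series} (h : ∀ α β, sCoeff α β f = sCoeff α β g) : f = g :=
  MvPowerSeries.ext fun α => MvPowerSeries.ext fun β => h α β

theorem sCoeff_add (α β : MultiIndex) (f g : Series) :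
    sCoeff α β (f + g) = sCoeff α β f + sCoeff α β g := by simp [sCoeff]

theorem sCoeff_sub (α β : MultiIndex) (f g : Series) :
    sCoeff α β (f - g) = sCoeff α β f - sCoeff α β g := by simp [sCoeff]

theorem sCoeff_zero (α β : MultiIndex) : sCoeff α β (0 : Series) = 0 := by simp [sCoeff]

theorem sCoeff_sum {ι : Type*} (s : Finset ι) (f : ι → Series) (α β : MultiIndex) :
    sCoeff α β (∑ i ∈ s, f i) = ∑ i ∈ s, sCoeff α β (f i) := by simp [sCoeff]

theorem sCoeff_mul (α β : MultiIndex) (f g : Series) :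
    sCoeff α β (f * g) = ∑ p ∈ Finset.HasAntidiagonal.antidiagonal α,
      ∑ q ∈ Finset.HasAntidiagonal.antidiagonal β, sCoeff p.1 q.1 f * sCoeff p.2 q.2 g := by
  simp [sCoeff, MvPowerSeries.coeff_mul]

section SeriesDerivations

variable {S : Type*} [CommRing S]

/-- The derivation `∂ / ∂ (X j)` of formal power series, regarded as an additive map. -/
def seriesDeriv (j : ℤ) : MvPowerSeries ℤ S →+ MvPowerSeries ℤ S :=
  (MvPowerSeries.pderiv S j : MvPowerSeries ℤ S →ₗ[S] MvPowerSeries ℤ S).toAddMonoidHom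

theorem seriesDeriv_mul (j : ℤ) (f g : MvPowerSeries ℤ S) :
    seriesDeriv j (f * g) = f * seriesDeriv j g + seriesDeriv j f * g := by
  rw [mul_comm (seriesDeriv j f)]
  exact (MvPowerSeries.pderiv S j).leibniz f g

theorem coeff_seriesDeriv (j : ℤ) (f : MvPowerSeries ℤ S) (α : MultiIndex) :
    MvPowerSeries.coeff α (seriesDeriv j f) =
      MvPowerSeries.coeff (α + unitIndex j) f * (α j + 1) :=
  MvPowerSeries.coeff_pderiv ..

/-- The additive map on formal power series that applies an additive map to each coefficient. -/
def coeffwise (D : S →+ S) : MvPowerSeries ℤ S →+ MvPowerSeries ℤ S :=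
  AddMonoidHom.mk' (fun f α => D (MvPowerSeries.coeff α f)) fun f g =>
    funext fun α => map_add D (MvPowerSeries.coeff α f) (MvPowerSeries.coeff α g)

theorem coeff_coeffwise (D : S →+ S) (f : MvPowerSeries ℤ S) (α : MultiIndex) :
    MvPowerSeries.coeff α (coeffwise D f) = D (MvPowerSeries.coeff α f) := rfl

theorem coeffwise_mul {D : S →+ S} (hD : ∀ x y, D (x * y) = x * D y + D x * y)
    (f g : MvPowerSeries ℤ S) :
    coeffwise D (f * g) = f * coeffwise D g + coeffwise D f * g := by
  refine MvPowerSeries.ext fun α => ?_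
  simp only [map_add, coeff_coeffwise, MvPowerSeries.coeff_mul, map_sum, hD,
    Finset.sum_add_distrib]

end SeriesDerivations

/-- The derivation `∂ / ∂ (u j)`. -/
def du (j : ℤ) : Series →+ Series := seriesDeriv j

/-- The derivation `∂ / ∂ (conj (u j))`. -/
def dubar (j : ℤ) : Series →+ Series := coeffwise (seriesDeriv j)

theorem du_mul (j : ℤ) (f g : Series) : du j (f * g) = f * du j g + du j f * g :=
  seriesDeriv_mul j f g

theorem dubar_mul (j : ℤ) (f g : Series) : dubar j (f * g) = f * dubar j g + dubar j f * g :=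
  coeffwise_mul (seriesDeriv_mul j) f g

theorem sCoeff_du (j : ℤ) (f : Series) (α β : MultiIndex) :
    sCoeff α β (du j f) = sCoeff (α + unitIndex j) β f * (α j + 1) := by
  rw [sCoeff, du, coeff_seriesDeriv, sCoeff]
  have h : ((α j : MvPowerSeries ℤ ℂ) + 1) = MvPowerSeries.C ((α j : ℂ) + 1) := by simp
  rw [h, MvPowerSeries.coeff_mul_C]

theorem sCoeff_dubar (j : ℤ) (f : Series) (α β : MultiIndex) :
    sCoeff α β (dubar j f) = sCoeff α (β + unitIndex j) f * (β j + 1) := by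
  rw [sCoeff, dubar, coeff_coeffwise, coeff_seriesDeriv, sCoeff]

theorem unitIndex_apply (i j : ℤ) : unitIndex i j = if i = j then 1 else 0 := by
  simp [unitIndex, Finsupp.single_apply]

theorem du_comm (i j : ℤ) (f : Series) : du i (du j f) = du j (du i f) := by
  refine sCoeff_ext fun α β => ?_
  simp only [sCoeff_du, Finsupp.add_apply, unitIndex_apply]
  rw [add_right_comm]
  by_cases h : i = j
  · subst h; rfl
  · simp [h, Ne.symm h]; ring

theorem dubar_comm (i j : ℤ) (f : Series) : dubar i (dubar j f) = dubar j (dubar i f) := by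
  refine sCoeff_ext fun α β => ?_
  simp only [sCoeff_dubar, Finsupp.add_apply, unitIndex_apply]
  rw [add_right_comm]
  by_cases h : i = j
  · subst h; rfl
  · simp [h, Ne.symm h]; ring

theorem dubar_du_comm (i j : ℤ) (f : Series) : dubar i (du j f) = du j (dubar i f) := by
  refine sCoeff_ext fun α β => ?_
  simp only [sCoeff_dubar, sCoeff_du]
  ring

/-- Multiplication by `u j * conj (u j)` turns the partial derivatives into Euler operators, which
act diagonally on monomials. -/
theorem sCoeff_poisson_summand (f g : Series) (α β : MultiIndex) (j : ℤ) :
    sCoeff α β (du j f * dubar j g - dubar j f * du j g) =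
      ∑ p ∈ Finset.HasAntidiagonal.antidiagonal (α + unitIndex j),
        ∑ q ∈ Finset.HasAntidiagonal.antidiagonal (β + unitIndex j),
          sCoeff p.1 q.1 f * sCoeff p.2 q.2 g *
            ((p.1 j : ℂ) * (q.2 j : ℂ) - (q.1 j : ℂ) * (p.2 j : ℂ)) := by
  let X : Series := MvPowerSeries.X j
  let Y : Series := MvPowerSeries.C (MvPowerSeries.X j)
  have hX : ∀ h : Series, ∀ a b, sCoeff (a + unitIndex j) b (X * h) = sCoeff a b h := by
    intro h a b
    rw [add_comm, sCoeff, sCoeff]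
    simp only [X, MvPowerSeries.X]
    rw [MvPowerSeries.coeff_add_monomial_mul, one_mul]
  have hX0 : ∀ h : Series, ∀ a b, a j = 0 → sCoeff a b (X * h) = 0 := by
    intro h a b ha
    simp only [sCoeff, X, MvPowerSeries.X]
    rw [MvPowerSeries.coeff_monomial_mul, if_neg, map_zero]
    rw [Finsupp.single_le_iff]; omega
  have hY : ∀ h : Series, ∀ a b, sCoeff a (b + unitIndex j) (Y * h) = sCoeff a b h := by
    intro h a b
    rw [add_comm, sCoeff, sCoeff]
    simp only [Y, MvPowerSeries.coeff_C_mul]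
    simp only [MvPowerSeries.X]
    rw [MvPowerSeries.coeff_add_monomial_mul, one_mul]
  have hY0 : ∀ h : Series, ∀ a b, b j = 0 → sCoeff a b (Y * h) = 0 := by
    intro h a b ha
    simp only [sCoeff, Y, MvPowerSeries.coeff_C_mul]
    simp only [MvPowerSeries.X]
    rw [MvPowerSeries.coeff_monomial_mul, if_neg]
    rw [Finsupp.single_le_iff]; omega
  have eX : ∀ h : Series, ∀ a b, sCoeff a b (X * du j h) = a j * sCoeff a b h := by
    intro h a b
    by_cases ha : a j = 0
    · rw [hX0 _ _ _ ha, ha]; simp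
    · obtain ⟨a', rfl, -⟩ := exists_sub_unit (a := a) (b := unitIndex j) rfl ha
      rw [hX, sCoeff_du]
      simp; ring
  have eY : ∀ h : Series, ∀ a b, sCoeff a b (Y * dubar j h) = b j * sCoeff a b h := by
    intro h a b
    by_cases hb : b j = 0
    · rw [hY0 _ _ _ hb, hb]; simp
    · obtain ⟨b', rfl, -⟩ := exists_sub_unit (a := b) (b := unitIndex j) rfl hb
      rw [hY, sCoeff_dubar]
      simp; ring
  rw [← hY, ← hX, show X * (Y * (du j f * dubar j g - dubar j f * du j g)) =
    (X * du j f) * (Y * dubar j g) - (Y * dubar j f) * (X * du j g) by ring, sCoeff_sub,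
    sCoeff_mul, sCoeff_mul]
  simp only [← Finset.sum_sub_distrib, eX, eY]
  refine Finset.sum_congr rfl fun p _ => Finset.sum_congr rfl fun q _ => ?_
  ring

/-- The formal power series of a formal Hamiltonian. -/
def toSeries (F : FormalHam) : Series := fun α β => coeff F α β

theorem sCoeff_toSeries (F : FormalHam) (α β : MultiIndex) :
    sCoeff α β (toSeries F) = coeff F α β := rfl

/-- A finite set of modes `j` outside of which the `j`-th summand of a Poisson bracket does not
contribute to the coefficient of `u ^ α * (conj u) ^ β`. By momentum conservation it can be chosen
independently of the two series. -/
def activeModes (α β : MultiIndex) : Finset ℤ :=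
  α.support ∪ β.support ∪
    (Finset.HasAntidiagonal.antidiagonal α ×ˢ Finset.HasAntidiagonal.antidiagonal β).biUnion
      fun s => {momentum s.1.1 s.2.1, - momentum s.1.1 s.2.1}

theorem mem_activeModes {α β α₁ α₂ β₁ β₂ : MultiIndex} {j : ℤ} (hα : α₁ + α₂ = α)
    (hβ : β₁ + β₂ = β) (hj : j = momentum α₁ β₁ ∨ j = - momentum α₁ β₁) :
    j ∈ activeModes α β := by
  refine Finset.mem_union_right _ (Finset.mem_biUnion.2 ⟨((α₁, α₂), (β₁, β₂)), ?_, ?_⟩)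
  · simp [hα, hβ]
  · simpa using hj

theorem sCoeff_poisson_summand_eq_zero {f : Series}
    (hf : ∀ a b, sCoeff a b f ≠ 0 → momentum a b = 0) (g : Series) {α β : MultiIndex} {j : ℤ}
    (hj : j ∉ activeModes α β) : sCoeff α β (du j f * dubar j g - dubar j f * du j g) = 0 := by
  rw [sCoeff_poisson_summand]
  refine Finset.sum_eq_zero fun p hp => Finset.sum_eq_zero fun q hq => ?_
  rw [Finset.HasAntidiagonal.mem_antidiagonal] at hp hq
  by_cases hfz : sCoeff p.1 q.1 f = 0
  · simp [hfz]
  have hm := hf _ _ hfz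
  -- a non-zero product of exponents puts `j` among the active modes
  have h1 : (p.1 j : ℂ) * (q.2 j : ℂ) = 0 := by
    by_contra hc
    have hc1 : p.1 j ≠ 0 := fun h => hc (by simp [h])
    have hc2 : q.2 j ≠ 0 := fun h => hc (by simp [h])
    obtain ⟨a, ha, ha'⟩ := exists_sub_unit hp hc1
    obtain ⟨b, -, hb'⟩ := exists_sub_unit ((add_comm q.2 q.1).trans hq) hc2
    refine hj (mem_activeModes ha' ((add_comm _ _).trans hb') (Or.inr ?_))
    rw [ha] at hm
    simp only [momentum, weight_add, weight_unit] at hm ⊢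
    linarith
  have h2 : (q.1 j : ℂ) * (p.2 j : ℂ) = 0 := by
    by_contra hc
    have hc1 : q.1 j ≠ 0 := fun h => hc (by simp [h])
    have hc2 : p.2 j ≠ 0 := fun h => hc (by simp [h])
    obtain ⟨b, hb, hb'⟩ := exists_sub_unit hq hc1
    obtain ⟨a, -, ha'⟩ := exists_sub_unit ((add_comm p.2 p.1).trans hp) hc2
    refine hj (mem_activeModes ((add_comm _ _).trans ha') hb' (Or.inl ?_))
    rw [hb] at hm
    simp only [momentum, weight_add, weight_unit] at hm ⊢
    linarith
  rw [h1, h2]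
  simp

theorem bracketTerm_eq_sCoeff (F G : FormalHam) (α β : MultiIndex) (j : ℤ) :
    bracketTerm F G α β j = sCoeff α β
      (du j (toSeries F) * dubar j (toSeries G) - dubar j (toSeries F) * du j (toSeries G)) := by
  rw [sCoeff_poisson_summand]
  rfl

theorem sCoeff_finPoisson_of_subset (F : FormalHam) (g : Series) {α β : MultiIndex} {J : Finset ℤ}
    (hJ : activeModes α β ⊆ J) :
    sCoeff α β (finPoisson du dubar J (toSeries F) g) =
      sCoeff α β (finPoisson du dubar (activeModes α β) (toSeries F) g) := by
  rw [finPoisson, finPoisson, sCoeff_sum, sCoeff_sum]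
  exact (Finset.sum_subset hJ fun j _ hj =>
    sCoeff_poisson_summand_eq_zero (fun _ _ => momentum_of_coeff_ne (F := F)) g hj).symm

theorem coeff_bracket_eq_sCoeff (F G : FormalHam) {α β : MultiIndex} {J : Finset ℤ}
    (hJ : activeModes α β ⊆ J) :
    coeff (bracket F G) α β =
      Complex.I * sCoeff α β (finPoisson du dubar J (toSeries F) (toSeries G)) := by
  rw [sCoeff_finPoisson_of_subset F _ hJ, coeff_bracket, finPoisson, sCoeff_sum]
  congr 1
  simp only [← bracketTerm_eq_sCoeff]
  refine finsum_eq_sum_of_support_subset _ fun j hj => ?_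
  by_contra hc
  refine hj ?_
  rw [bracketTerm_eq_sCoeff]
  exact sCoeff_poisson_summand_eq_zero (fun _ _ => momentum_of_coeff_ne (F := F)) _ hc

/-- Each coefficient of a double Poisson bracket is computed by finitely many modes, uniformly in
the three Hamiltonians. -/
theorem exists_coeff_bracket_bracket_eq (α β : MultiIndex) :
    ∃ J : Finset ℤ, ∀ F G H : FormalHam, coeff (bracket F (bracket G H)) α β =
      - sCoeff α β (finPoisson du dubar J (toSeries F)
        (finPoisson du dubar J (toSeries G) (toSeries H))) := by
  let J : Finset ℤ := activeModes α β ∪ (activeModes α β).biUnion fun j =>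
    (Finset.HasAntidiagonal.antidiagonal (α + unitIndex j) ×ˢ
      Finset.HasAntidiagonal.antidiagonal (β + unitIndex j)).biUnion fun s =>
        activeModes s.1.2 s.2.2
  have hJ : activeModes α β ⊆ J := Finset.subset_union_left
  refine ⟨J, fun F G H => ?_⟩
  rw [coeff_bracket_eq_sCoeff F _ subset_rfl, sCoeff_finPoisson_of_subset F _ hJ, finPoisson,
    finPoisson, sCoeff_sum, sCoeff_sum, Finset.mul_sum, ← Finset.sum_neg_distrib]
  refine Finset.sum_congr rfl fun j hj => ?_
  rw [sCoeff_poisson_summand, sCoeff_poisson_summand, Finset.mul_sum, ← Finset.sum_neg_distrib]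
  refine Finset.sum_congr rfl fun p hp => ?_
  rw [Finset.mul_sum, ← Finset.sum_neg_distrib]
  refine Finset.sum_congr rfl fun q hq => ?_
  have hs : activeModes p.2 q.2 ⊆ J := fun k hk => Finset.mem_union_right _
    (Finset.mem_biUnion.2 ⟨j, hj, Finset.mem_biUnion.2
      ⟨(p, q), Finset.mem_product.2 ⟨hp, hq⟩, hk⟩⟩)
  rw [sCoeff_toSeries (bracket G H), coeff_bracket_eq_sCoeff G H hs]
  linear_combination (sCoeff p.1 q.1 (toSeries F) *
    sCoeff p.2 q.2 (finPoisson du dubar J (toSeries G) (toSeries H)) *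
    ((p.1 j : ℂ) * (q.2 j : ℂ) - (q.1 j : ℂ) * (p.2 j : ℂ))) * Complex.I_mul_I

instance : IsAddTorsionFree Series :=
  inferInstanceAs (IsAddTorsionFree (MultiIndex → MultiIndex → ℂ))

theorem bracket_jacobi (F G H : FormalHam) :
    bracket F (bracket G H) + bracket G (bracket H F) + bracket H (bracket F G) = 0 := by
  ext α β
  obtain ⟨J, hJ⟩ := exists_coeff_bracket_bracket_eq α β
  have h := congrArg (sCoeff α β) (finPoisson_jacobi du dubar du_mul dubar_mul du_comm dubar_comm
    dubar_du_comm J (toSeries F) (toSeries G) (toSeries H))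
  rw [sCoeff_add, sCoeff_add, sCoeff_zero] at h
  rw [coeff_add, coeff_add, hJ, hJ, hJ]
  change _ = (0 : ℂ)
  linear_combination -h

theorem bracket_swap (F G : FormalHam) : bracket G F = - bracket F G := by
  ext α β
  rw [coeff_bracket_eq_sCoeff G F subset_rfl]
  change _ = - coeff (bracket F G) α β
  rw [coeff_bracket_eq_sCoeff F G subset_rfl, ← mul_neg]
  congr 1
  rw [finPoisson, finPoisson, sCoeff_sum, sCoeff_sum, ← Finset.sum_neg_distrib]
  refine Finset.sum_congr rfl fun j _ => ?_
  rw [sCoeff_sub, sCoeff_sub, neg_sub, mul_comm (du j (toSeries G)),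
    mul_comm (du j (toSeries F))]

/-- The Lie algebra of formal Hamiltonians under the Poisson bracket. -/
instance : LieRing FormalHam where
  bracket := bracket
  add_lie F G H := by
    rw [bracket_swap H, bracket_swap H F, bracket_swap H G, ← neg_add, neg_inj]
    exact map_add (ad H) F G
  lie_add F G H := map_add (ad F) G H
  lie_self F := ext_coeff fun α β =>
    self_eq_neg.1 (congrArg (fun H => coeff H α β) (bracket_swap F F))
  leibniz_lie F G H := by
    have := bracket_jacobi F G H
    rw [bracket_swap F H, bracket_swap (bracket F G) H, show bracket G (-bracket F H) =
      -bracket G (bracket F H) from map_neg (ad G) _] at this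
    rw [eq_comm, ← sub_eq_zero, ← neg_eq_zero, ← this]
    abel

instance : LieAlgebra ℝ FormalHam where
  lie_smul r F G := map_smul (ad F) r G

theorem ad_apply (F G : FormalHam) : ad F G = ⁅F, G⁆ := rfl

theorem lie_mem_hamGE {F G : FormalHam} {d e n : ℕ} (hF : F ∈ hamGE d) (hG : G ∈ hamGE e)
    (h : n ≤ d + e) : ⁅F, G⁆ ∈ hamGE n :=
  fun α β hαβ => bracket_mem hF hG α β (by omega)

/-! ### Convergence in the scaling degree -/

theorem hamGE_anti {d e : ℕ} (h : d ≤ e) : hamGE e ≤ hamGE d :=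
  fun _ hH α β hαβ => hH α β (by omega)

theorem eq_of_forall_sub_mem {F G : FormalHam} (h : ∀ n, F - G ∈ hamGE n) : F = G := by
  ext α β
  exact sub_eq_zero.1 (h (totalDegree α β) α β (by omega))

/-- The space of formal Hamiltonians is complete for the filtration by scaling degree. -/
theorem exists_limit {x : ℕ → FormalHam} (hx : ∀ n, x (n + 1) - x n ∈ hamGE n) :
    ∃ y, ∀ n, y - x n ∈ hamGE n := by
  have hx' : ∀ n k, x (n + k) - x n ∈ hamGE n := by
    intro n k
    induction k with
    | zero => simp
    | succ k ih =>
      have := add_mem (hamGE_anti (Nat.le_add_right n k) (hx (n + k))) ih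
      rwa [sub_add_sub_cancel] at this
  have hc : ∀ n m α β, totalDegree α β < n + 2 → n ≤ m →
      coeff (x m) α β = coeff (x n) α β := by
    intro n m α β h hnm
    obtain ⟨k, rfl⟩ := Nat.exists_eq_add_of_le hnm
    exact sub_eq_zero.1 (hx' n k α β h)
  refine ⟨⟨fun p => coeff (x (totalDegree p.1 p.2)) p.1 p.2, (x _).2.1, (x _).2.2.1,
    (x _).2.2.2.1, fun α β => ?_, fun α β => (x _).2.2.2.2.2 α β⟩, fun n α β h => ?_⟩
  · dsimp only
    rw [coeff_conj, show totalDegree α β = totalDegree β α from Nat.add_comm _ _]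
  · change coeff (x (totalDegree α β)) α β - coeff (x n) α β = 0
    rw [sub_eq_zero]
    rcases le_total n (totalDegree α β) with hn | hn
    · exact hc _ _ _ _ h hn
    · exact (hc _ _ _ _ (by omega) hn).symm

/-- `S` is the sum of the series `∑ s n`, where the remainder after `N` terms has scaling degree at
least `N`. -/
def HamSum (s : ℕ → FormalHam) (S : FormalHam) : Prop :=
  ∀ N, S - ∑ n ∈ Finset.range N, s n ∈ hamGE N

theorem exists_hamSum {s : ℕ → FormalHam} (hs : ∀ n, s n ∈ hamGE n) : ∃ S, HamSum s S :=
  exists_limit (x := fun N => ∑ n ∈ Finset.range N, s n) fun n => by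
    simpa [Finset.sum_range_succ] using hs n

theorem HamSum.unique {s : ℕ → FormalHam} {S T : FormalHam} (hS : HamSum s S) (hT : HamSum s T) :
    S = T :=
  eq_of_forall_sub_mem fun n => by simpa using sub_mem (hS n) (hT n)

theorem HamSum.add {s t : ℕ → FormalHam} {S T : FormalHam} (hS : HamSum s S) (hT : HamSum t T) :
    HamSum (fun n => s n + t n) (S + T) := fun n => by
  rw [Finset.sum_add_distrib, add_sub_add_comm]
  exact add_mem (hS n) (hT n)

theorem HamSum.sub {s t : ℕ → FormalHam} {S T : FormalHam} (hS : HamSum s S) (hT : HamSum t T) :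
    HamSum (fun n => s n - t n) (S - T) := fun n => by
  rw [Finset.sum_sub_distrib, sub_sub_sub_comm]
  exact sub_mem (hS n) (hT n)

theorem HamSum.map {s : ℕ → FormalHam} {S : FormalHam} (hS : HamSum s S)
    (T : Module.End ℝ FormalHam) (hT : ∀ n, ∀ H ∈ hamGE n, T H ∈ hamGE n) :
    HamSum (fun n => T (s n)) (T S) := fun n => by
  rw [← map_sum, ← map_sub]
  exact hT n _ (hS n)

theorem HamSum.sub_sum_range_mem {s : ℕ → FormalHam} {S : FormalHam} (hS : HamSum s S) {M m : ℕ}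
    (hs : ∀ n ≥ M, s n ∈ hamGE m) : S - ∑ n ∈ Finset.range M, s n ∈ hamGE m := by
  have h : ∑ n ∈ Finset.range (M + m), s n - ∑ n ∈ Finset.range M, s n ∈ hamGE m := by
    rw [Finset.sum_range_add, add_sub_cancel_left]
    exact sum_mem fun k _ => hs _ (by omega)
  simpa using add_mem (hamGE_anti (Nat.le_add_left m M) (hS (M + m))) h

theorem HamSum.mem {s : ℕ → FormalHam} {S : FormalHam} (hS : HamSum s S) {m : ℕ}
    (hs : ∀ n, s n ∈ hamGE m) : S ∈ hamGE m := by
  simpa using hS.sub_sum_range_mem (M := 0) fun n _ => hs n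

/-- A double series may be summed along antidiagonals. -/
theorem HamSum.antidiagonal {s : ℕ → ℕ → FormalHam} {R : ℕ → FormalHam} {S : FormalHam}
    (hs : ∀ i j, s i j ∈ hamGE (i + j)) (hR : ∀ i, HamSum (s i) (R i)) (hS : HamSum R S) :
    HamSum (fun n => ∑ p ∈ Finset.HasAntidiagonal.antidiagonal n, s p.1 p.2) S := fun N => by
  simp only [Finset.Nat.sum_antidiagonal_eq_sum_range_succ s]
  rw [Finset.sum_range_diag_flip, ← sub_add_sub_cancel S (∑ i ∈ Finset.range N, R i),
    ← Finset.sum_sub_distrib]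
  refine add_mem (hS N) (sum_mem fun i _ => (hR i).sub_sum_range_mem fun j hj => ?_)
  exact hamGE_anti (by omega) (hs i j)

theorem HamSum.lie {s t : ℕ → FormalHam} {S T : FormalHam} (hs : ∀ n, s n ∈ hamGE n)
    (ht : ∀ n, t n ∈ hamGE n) (hS : HamSum s S) (hT : HamSum t T) :
    HamSum (fun n => ∑ p ∈ Finset.HasAntidiagonal.antidiagonal n, ⁅s p.1, t p.2⁆) ⁅S, T⁆ := by
  refine HamSum.antidiagonal (s := fun i j => ⁅s i, t j⁆) (R := fun i => ⁅s i, T⁆)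
    (fun i j => lie_mem_hamGE (hs i) (ht j) le_rfl)
    (fun i => hT.map (ad (s i)) fun n H hH => lie_mem_hamGE (hs i) hH (by omega)) ?_
  have h := hS.map (-ad T) fun n H hH =>
    neg_mem (lie_mem_hamGE (mem_hamGE_zero T) hH (Nat.le_add_left n 0))
  simpa only [LinearMap.neg_apply, ad_apply, lie_skew] using h

theorem coeff_sub (F G : FormalHam) (α β : MultiIndex) :
    coeff (F - G) α β = coeff F α β - coeff G α β := rfl

theorem coeff_sum {ι : Type*} (s : Finset ι) (f : ι → FormalHam) (α β : MultiIndex) :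
    coeff (∑ i ∈ s, f i) α β = ∑ i ∈ s, coeff (f i) α β := by
  let T : FormalHam →+ ℂ := AddMonoidHom.mk' (fun F => coeff F α β) fun F G => coeff_add F G α β
  exact map_sum T f s

/-! ### The scaling derivation -/

/-- The derivation that multiplies the monomials of total degree `n` by their scaling degree
`n - 2`. -/
def scaling : Module.End ℝ FormalHam where
  toFun H := ⟨fun p => ((totalDegree p.1 p.2 : ℝ) - 2) • coeff H p.1 p.2, by
    refine ⟨?_, ?_, ?_, fun α β => ?_, fun α β h => ?_⟩
    · simp [show coeff H 0 0 = 0 from H.2.1]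
    · simp [show coeff H (unitIndex 0) 0 = 0 from H.2.2.1]
    · simp [show coeff H 0 (unitIndex 0) = 0 from H.2.2.2.1]
    · simp only [coeff_conj H α β, Complex.real_smul, map_mul, Complex.conj_ofReal]
      rw [show totalDegree α β = totalDegree β α from Nat.add_comm _ _]
    · simp [show coeff H α β = 0 from H.2.2.2.2.2 α β h]⟩
  map_add' F G := by
    ext α β
    exact smul_add _ (coeff F α β) (coeff G α β)
  map_smul' r F := by
    ext α β
    exact smul_comm _ r (coeff F α β)

theorem coeff_scaling (H : FormalHam) (α β : MultiIndex) :
    coeff (scaling H) α β = ((totalDegree α β : ℝ) - 2) • coeff H α β := rfl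

theorem scaling_mem {n : ℕ} {H : FormalHam} (hH : H ∈ hamGE n) : scaling H ∈ hamGE n :=
  fun α β h => by rw [coeff_scaling, hH α β h, smul_zero]

theorem mem_of_scaling_mem {n : ℕ} {H : FormalHam} (h1 : H ∈ hamGE 1) (hH : scaling H ∈ hamGE n) :
    H ∈ hamGE n := fun α β h => by
  have h2 := hH α β h
  rw [coeff_scaling, smul_eq_zero] at h2
  refine h2.elim (fun h3 => h1 α β ?_) id
  have : totalDegree α β = 2 := by exact_mod_cast sub_eq_zero.1 h3
  omega

theorem exists_scaling_eq {H : FormalHam} (hH : H ∈ hamGE 1) :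
    ∃ F ∈ hamGE 1, scaling F = H := by
  refine ⟨⟨fun p => ((totalDegree p.1 p.2 : ℝ) - 2)⁻¹ • coeff H p.1 p.2, ?_, ?_, ?_,
    fun α β => ?_, fun α β h => ?_⟩, fun α β h => ?_, ?_⟩
  · simp [show coeff H 0 0 = 0 from H.2.1]
  · simp [show coeff H (unitIndex 0) 0 = 0 from H.2.2.1]
  · simp [show coeff H 0 (unitIndex 0) = 0 from H.2.2.2.1]
  · simp only [coeff_conj H α β, Complex.real_smul, map_mul, Complex.conj_ofReal]
    rw [show totalDegree α β = totalDegree β α from Nat.add_comm _ _]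
  · simp [show coeff H α β = 0 from H.2.2.2.2.2 α β h]
  · change _ • coeff H α β = 0
    rw [hH α β h, smul_zero]
  · ext α β
    rw [coeff_scaling]
    change _ • _ • coeff H α β = coeff H α β
    by_cases h : totalDegree α β < 3
    · rw [hH α β h, smul_zero, smul_zero]
    · refine smul_inv_smul₀ (sub_ne_zero.2 ?_) _
      exact_mod_cast (by omega : totalDegree α β ≠ 2)

theorem scaling_lie (F G : FormalHam) : scaling ⁅F, G⁆ = ⁅scaling F, G⁆ + ⁅F, scaling G⁆ := by
  ext α β
  change _ • coeff (bracket F G) α β =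
    coeff (bracket (scaling F) G) α β + coeff (bracket F (scaling G)) α β
  simp only [coeff_bracket]
  rw [← mul_add, ← finsum_add_distrib (finite_support_bracketTerm _ _ _ _)
      (finite_support_bracketTerm _ _ _ _), Complex.real_smul, mul_left_comm, mul_finsum]
  congr 1
  refine finsum_congr fun j => ?_
  simp only [bracketTerm, Finset.mul_sum, ← Finset.sum_add_distrib, coeff_scaling,
    Complex.real_smul]
  refine Finset.sum_congr rfl fun p hp => Finset.sum_congr rfl fun q hq => ?_
  have h1 := congrArg Finsupp.degree (Finset.HasAntidiagonal.mem_antidiagonal.1 hp)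
  have h2 := congrArg Finsupp.degree (Finset.HasAntidiagonal.mem_antidiagonal.1 hq)
  simp only [map_add, Finsupp.degree_single] at h1 h2
  -- a bracket loses one factor `u j` and one factor `conj (u j)`
  have h3 : totalDegree p.1 q.1 + totalDegree p.2 q.2 = totalDegree α β + 2 := by
    unfold totalDegree; omega
  have h4 : (totalDegree α β : ℂ) = totalDegree p.1 q.1 + totalDegree p.2 q.2 - 2 := by
    rw [eq_sub_iff_add_eq]; exact_mod_cast h3.symm
  push_cast
  rw [h4]
  ring

/-- On Hamiltonians of scaling degree at least `n` the scaling derivation is multiplication by `n`,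
up to terms of higher degree. -/
theorem scaling_sub_smul_mem {n : ℕ} {H : FormalHam} (hH : H ∈ hamGE n) :
    scaling H - (n : ℝ) • H ∈ hamGE (n + 1) := fun α β h => by
  rw [coeff_sub, coeff_scaling, coeff_smul, ← sub_smul]
  rcases Nat.lt_or_ge (totalDegree α β) (n + 2) with h1 | h1
  · rw [hH α β h1, smul_zero]
  · have : totalDegree α β = n + 2 := by omega
    rw [this]
    simp

/-! ### The exponential series -/

/-- The `n`-th term `ad_K ^ n / n!` of the exponential series. -/
def expPow (K : FormalHam) (n : ℕ) : Module.End ℝ FormalHam := (n ! : ℝ)⁻¹ • ad K ^ n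

theorem expPow_zero (K H : FormalHam) : expPow K 0 H = H := by simp [expPow]

theorem succ_mul_inv_factorial_succ (n : ℕ) :
    ((n : ℝ) + 1) * ((n + 1)! : ℝ)⁻¹ = (n ! : ℝ)⁻¹ := by
  have : (n ! : ℝ) ≠ 0 := by positivity
  rw [Nat.factorial_succ]
  push_cast
  field_simp

theorem succ_smul_expPow_succ (K H : FormalHam) (n : ℕ) :
    ((n : ℝ) + 1) • expPow K (n + 1) H = ⁅K, expPow K n H⁆ := by
  rw [expPow, LinearMap.smul_apply, smul_smul, succ_mul_inv_factorial_succ, pow_succ',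
    Module.End.mul_apply, ← map_smul, expPow]
  rfl

theorem ad_pow_mem_add {K H : FormalHam} {d : ℕ} (hK : K ∈ hamGE 1) (hH : H ∈ hamGE d) (n : ℕ) :
    (ad K ^ n) H ∈ hamGE (d + n) := by
  induction n with
  | zero => exact hH
  | succ n ih =>
    rw [pow_succ', Module.End.mul_apply]
    exact lie_mem_hamGE hK ih (by omega)

theorem expPow_mem {K H : FormalHam} {d : ℕ} (hK : K ∈ hamGE 1) (hH : H ∈ hamGE d) (n : ℕ) :
    expPow K n H ∈ hamGE (d + n) :=
  Submodule.smul_mem _ _ (ad_pow_mem_add hK hH n)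

theorem hamSum_expAd (G : hamGE 1) (H : FormalHam) :
    HamSum (fun n => expPow G n H) (expAd G H) := fun N α β h => by
  rw [coeff_sub, coeff_sum, sub_eq_zero]
  change ∑ᶠ k, expTerm G H α β k = ∑ k ∈ Finset.range N, expTerm G H α β k
  refine finsum_eq_sum_of_support_subset _ fun k hk => ?_
  by_contra hc
  simp only [Finset.coe_range, Set.mem_Iio, not_lt] at hc
  exact hk (by rw [expTerm, ad_pow_mem G H k α β (by omega), smul_zero])

theorem expAd_mem (G : hamGE 1) {H : FormalHam} {d : ℕ} (hH : H ∈ hamGE d) :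
    expAd G H ∈ hamGE d :=
  (hamSum_expAd G H).mem fun n => hamGE_anti (by omega) (expPow_mem G.2 hH n)

theorem expAd_sub_self_mem (G : hamGE 1) {H : FormalHam} {d e : ℕ} (hG : (G : FormalHam) ∈ hamGE e)
    (hH : H ∈ hamGE d) : expAd G H - H ∈ hamGE (e + d) := by
  have h := (hamSum_expAd G H).sub_sum_range_mem (M := 1) (m := e + d) fun n hn => by
    obtain ⟨k, rfl⟩ := Nat.exists_eq_add_of_le' hn
    refine Submodule.smul_mem _ _ ?_
    rw [pow_succ', Module.End.mul_apply]
    exact lie_mem_hamGE hG (hamGE_anti (Nat.le_add_right d k) (ad_pow_mem_add G.2 hH k)) le_rfl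
  simpa [expPow_zero] using h

theorem ad_pow_sub_mem {K Q X Y : FormalHam} {j : ℕ} (hKQ : K - Q ∈ hamGE j)
    (hXY : X - Y ∈ hamGE j) (n : ℕ) : (ad K ^ n) X - (ad Q ^ n) Y ∈ hamGE j := by
  induction n with
  | zero => exact hXY
  | succ n ih =>
    rw [pow_succ', pow_succ', Module.End.mul_apply, Module.End.mul_apply, ad_apply, ad_apply,
      ← sub_add_sub_cancel _ ⁅Q, (ad K ^ n) X⁆, ← sub_lie, ← lie_sub]
    exact add_mem (lie_mem_hamGE hKQ (mem_hamGE_zero _) (by omega))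
      (lie_mem_hamGE (mem_hamGE_zero _) ih (by omega))

theorem expAd_sub_expAd_mem {K Q : hamGE 1} {j : ℕ} (h : (K - Q : FormalHam) ∈ hamGE j)
    (H : FormalHam) : expAd K H - expAd Q H ∈ hamGE j :=
  ((hamSum_expAd K H).sub (hamSum_expAd Q H)).mem fun n => by
    rw [expPow, expPow, LinearMap.smul_apply, LinearMap.smul_apply, ← smul_sub]
    exact Submodule.smul_mem _ _ (ad_pow_sub_mem h (by simp) n)

/-- The Euler identity for a function on the antidiagonal of `n + 1`. -/
theorem succ_smul_sum_antidiagonal (f : ℕ → ℕ → FormalHam) (n : ℕ) :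
    ((n : ℝ) + 1) • ∑ p ∈ Finset.HasAntidiagonal.antidiagonal (n + 1), f p.1 p.2 =
      ∑ p ∈ Finset.HasAntidiagonal.antidiagonal n,
        (((p.1 : ℝ) + 1) • f (p.1 + 1) p.2 + ((p.2 : ℝ) + 1) • f p.1 (p.2 + 1)) := by
  have h : ((n : ℝ) + 1) • ∑ p ∈ Finset.HasAntidiagonal.antidiagonal (n + 1), f p.1 p.2 =
      ∑ p ∈ Finset.HasAntidiagonal.antidiagonal (n + 1), (p.1 : ℝ) • f p.1 p.2 +
      ∑ p ∈ Finset.HasAntidiagonal.antidiagonal (n + 1), (p.2 : ℝ) • f p.1 p.2 := by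
    rw [Finset.smul_sum, ← Finset.sum_add_distrib]
    refine Finset.sum_congr rfl fun p hp => ?_
    rw [← add_smul]
    congr 1
    exact_mod_cast (Finset.HasAntidiagonal.mem_antidiagonal.1 hp).symm
  rw [h, Finset.Nat.sum_antidiagonal_succ, Finset.Nat.sum_antidiagonal_succ',
    Finset.sum_add_distrib]
  simp

theorem expPow_lie (K F G : FormalHam) (n : ℕ) :
    expPow K n ⁅F, G⁆ =
      ∑ p ∈ Finset.HasAntidiagonal.antidiagonal n, ⁅expPow K p.1 F, expPow K p.2 G⁆ := by
  induction n with
  | zero => simp [expPow_zero]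
  | succ n ih =>
    have hn : ((n : ℝ) + 1) ≠ 0 := by positivity
    refine smul_right_injective _ hn ?_
    dsimp only
    rw [succ_smul_expPow_succ, ih,
      succ_smul_sum_antidiagonal fun p q => ⁅expPow K p F, expPow K q G⁆, ← ad_apply, map_sum]
    refine Finset.sum_congr rfl fun p _ => ?_
    rw [ad_apply, leibniz_lie, ← succ_smul_expPow_succ, ← succ_smul_expPow_succ, smul_lie, lie_smul]

/-- Formal symplectic changes of variables are automorphisms of the Lie algebra. -/
theorem expAd_lie (G : hamGE 1) (F H : FormalHam) :
    expAd G ⁅F, H⁆ = ⁅expAd G F, expAd G H⁆ := by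
  have hm : ∀ H n, expPow G n H ∈ hamGE n := fun H n =>
    hamGE_anti (by omega) (expPow_mem G.2 (mem_hamGE_zero H) n)
  refine (hamSum_expAd G _).unique ?_
  simp only [expPow_lie]
  exact HamSum.lie (s := fun n => expPow G n F) (t := fun n => expPow G n H) (hm F) (hm H) (hamSum_expAd G F) (hamSum_expAd G H)

theorem expAd_zero : expAd 0 = 1 := by
  refine LinearMap.ext fun H => eq_of_forall_sub_mem fun n => ?_
  exact hamGE_anti (Nat.le_add_right n 0)
    (expAd_sub_self_mem 0 (Submodule.zero_mem (hamGE n)) (mem_hamGE_zero H))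

theorem expPow_lie_self (K H : FormalHam) (n : ℕ) : expPow K n ⁅K, H⁆ = ⁅K, expPow K n H⁆ := by
  rw [expPow, LinearMap.smul_apply, LinearMap.smul_apply, lie_smul, ← ad_apply, ← ad_apply,
    ← Module.End.mul_apply, ← Module.End.mul_apply, ← pow_succ, ← pow_succ']

theorem expAd_mul_expAd_neg (G : hamGE 1) : expAd G * expAd (-G) = 1 := by
  refine LinearMap.ext fun H => ?_
  rw [Module.End.mul_apply, Module.End.one_apply]
  have hG : (-G : FormalHam) ∈ hamGE 1 := neg_mem G.2
  have h1 := HamSum.antidiagonal (s := fun i j => expPow G i (expPow (-G : FormalHam) j H))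
    (R := fun i => expPow G i (expAd (-G) H))
    (fun i j => by
      have := expPow_mem G.2 (expPow_mem hG (mem_hamGE_zero H) j) i
      exact hamGE_anti (by omega) this)
    (fun i => (hamSum_expAd (-G) H).map _ fun n F hF => hamGE_anti (by omega) (expPow_mem G.2 hF i))
    (hamSum_expAd G _)
  -- all antidiagonal sums of positive index vanish
  have h2 : ∀ n, ∑ p ∈ Finset.HasAntidiagonal.antidiagonal (n + 1),
      expPow G p.1 (expPow (-G : FormalHam) p.2 H) = 0 := by
    intro n
    have hn : ((n : ℝ) + 1) ≠ 0 := by positivity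
    refine smul_right_injective _ hn ?_
    dsimp only
    rw [succ_smul_sum_antidiagonal fun p q => expPow G p (expPow (-G : FormalHam) q H), smul_zero]
    refine Finset.sum_eq_zero fun p _ => ?_
    rw [succ_smul_expPow_succ, ← map_smul, succ_smul_expPow_succ, neg_lie, map_neg,
      expPow_lie_self, add_neg_cancel]
  refine eq_of_forall_sub_mem fun m => ?_
  have h3 := h1.sub_sum_range_mem (M := 1) (m := m) fun n hn => by
    obtain ⟨k, rfl⟩ := Nat.exists_eq_add_of_le' hn
    rw [h2]
    exact zero_mem _
  simpa [expPow_zero] using h3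

/-! ### The logarithmic derivative of the exponential -/

/-- The terms `ad_K ^ p (scaling K) / (p + 1)!` of the logarithmic derivative of `exp {K, ·}` along
the scaling derivation, placed at index `p + 1` so that the term of index `n` has scaling degree at
least `n`. -/
def logDerivTerm (K : FormalHam) : ℕ → FormalHam
  | 0 => 0
  | p + 1 => ((p + 1)! : ℝ)⁻¹ • (ad K ^ p) (scaling K)

theorem logDerivTerm_zero (K : FormalHam) : logDerivTerm K 0 = 0 := rfl

theorem logDerivTerm_one (K : FormalHam) : logDerivTerm K 1 = scaling K := by simp [logDerivTerm]

theorem logDerivTerm_mem {K : FormalHam} {d : ℕ} (hK : K ∈ hamGE 1) (hd : K ∈ hamGE d) (n : ℕ) :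
    logDerivTerm K (n + 1) ∈ hamGE (d + n) :=
  Submodule.smul_mem _ _ (ad_pow_mem_add hK (scaling_mem hd) n)

theorem logDerivTerm_mem_self {K : FormalHam} (hK : K ∈ hamGE 1) :
    ∀ n, logDerivTerm K n ∈ hamGE n
  | 0 => zero_mem _
  | n + 1 => hamGE_anti (by omega) (logDerivTerm_mem hK hK n)

theorem succ_smul_logDerivTerm_succ (K : FormalHam) (n : ℕ) :
    ((n : ℝ) + 1) • logDerivTerm K (n + 1) =
      ⁅K, logDerivTerm K n⁆ + if n = 0 then scaling K else 0 := by
  rw [logDerivTerm, smul_smul, succ_mul_inv_factorial_succ]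
  cases n with
  | zero => simp [logDerivTerm]
  | succ n =>
    rw [logDerivTerm, pow_succ', Module.End.mul_apply, lie_smul]
    simp [ad_apply]

theorem scaling_expPow (K H : FormalHam) (n : ℕ) :
    scaling (expPow K n H) = expPow K n (scaling H) +
      ∑ p ∈ Finset.HasAntidiagonal.antidiagonal n, ⁅logDerivTerm K p.1, expPow K p.2 H⁆ := by
  induction n with
  | zero => simp [expPow_zero, logDerivTerm]
  | succ n ih =>
    have hn : ((n : ℝ) + 1) ≠ 0 := by positivity
    have h0 : ∑ p ∈ Finset.HasAntidiagonal.antidiagonal n,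
        ⁅(if p.1 = 0 then scaling K else 0), expPow K p.2 H⁆ = ⁅scaling K, expPow K n H⁆ := by
      rw [Finset.sum_eq_single (0, n)]
      · simp
      · rintro ⟨p, q⟩ hp hne
        rw [if_neg, zero_lie]
        rintro rfl
        rw [Finset.HasAntidiagonal.mem_antidiagonal] at hp
        exact hne (by simp_all)
      · simp
    refine smul_right_injective _ hn ?_
    dsimp only
    rw [← map_smul, succ_smul_expPow_succ, scaling_lie, ih, smul_add, succ_smul_expPow_succ,
      lie_add, succ_smul_sum_antidiagonal fun p q => ⁅logDerivTerm K p, expPow K q H⁆, ← h0,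
      ← ad_apply K (∑ p ∈ _, _), map_sum, add_left_comm, ← Finset.sum_add_distrib]
    congr 1
    refine Finset.sum_congr rfl fun p _ => ?_
    rw [← smul_lie, ← lie_smul, succ_smul_logDerivTerm_succ, succ_smul_expPow_succ, ad_apply,
      leibniz_lie, add_lie]
    abel

/-- The operator `E` satisfies the linear differential equation `[scaling, E] = {y, E ·}`. -/
def HasLogDeriv (E : Module.End ℝ FormalHam) (y : FormalHam) : Prop :=
  ∀ H, scaling (E H) = E (scaling H) + ⁅y, E H⁆

theorem hasLogDeriv_expAd {K : hamGE 1} {y : FormalHam} (hy : HamSum (logDerivTerm K) y) :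
    HasLogDeriv (expAd K) y := fun H => by
  refine ((hamSum_expAd K H).map scaling fun n F => scaling_mem).unique ?_
  simp only [scaling_expPow]
  refine (hamSum_expAd K _).add ?_
  exact HamSum.lie (s := logDerivTerm K) (t := fun n => expPow K n H) (logDerivTerm_mem_self K.2)
    (fun n => hamGE_anti (by omega) (expPow_mem K.2 (mem_hamGE_zero H) n)) hy (hamSum_expAd K H)

theorem HasLogDeriv.expAd_mul {G : hamGE 1} {E : Module.End ℝ FormalHam} {f g : FormalHam}
    (hG : HasLogDeriv (expAd G) g) (hE : HasLogDeriv E f) :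
    HasLogDeriv (expAd G * E) (g + expAd G f) := fun H => by
  simp only [Module.End.mul_apply]
  rw [hG, hE, map_add, expAd_lie, add_lie]
  abel

/-- An operator tangent to the identity is determined by its logarithmic derivative: the difference
of two solutions raises the scaling degree by some `n ≥ 1`, its commutator with the scaling
derivation is then multiplication by `n` to leading order, but has higher order by the equation. -/
theorem HasLogDeriv.unique {E E' : Module.End ℝ FormalHam} {y : FormalHam} (hy : y ∈ hamGE 1)
    (h : HasLogDeriv E y) (h' : HasLogDeriv E' y)
    (hE : ∀ d, ∀ H ∈ hamGE d, E H - H ∈ hamGE (d + 1))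
    (hE' : ∀ d, ∀ H ∈ hamGE d, E' H - H ∈ hamGE (d + 1)) : E = E' := by
  have key : ∀ n d, ∀ H ∈ hamGE d, (E - E') H ∈ hamGE (d + (n + 1)) := by
    have hW : ∀ H, scaling ((E - E') H) = (E - E') (scaling H) + ⁅y, (E - E') H⁆ := by
      intro H
      simp only [LinearMap.sub_apply, map_sub, lie_sub]
      rw [h, h']
      abel
    generalize hWdef : E - E' = W at hW
    intro n
    induction n with
    | zero =>
      intro d H hH
      have := sub_mem (hE d H hH) (hE' d H hH)
      rwa [sub_sub_sub_cancel_right, ← LinearMap.sub_apply, hWdef] at this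
    | succ n ih =>
      intro d H hH
      have h1 := scaling_sub_smul_mem (ih d H hH)
      have h2 := ih (d + 1) _ (scaling_sub_smul_mem hH)
      have h3 : ⁅y, W H⁆ ∈ hamGE (d + (n + 1) + 1) := lie_mem_hamGE hy (ih d H hH) (by omega)
      rw [map_sub, map_smul] at h2
      rw [hW] at h1
      have h4 := sub_mem (add_mem (hamGE_anti (by omega) h2) h3) h1
      have hn : ((n : ℝ) + 1) ≠ 0 := by positivity
      refine (Submodule.smul_mem_iff _ hn).1 ?_
      have h5 : ((n : ℝ) + 1) • W H = W (scaling H) - (d : ℝ) • W H + ⁅y, W H⁆ -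
          (W (scaling H) + ⁅y, W H⁆ - ((d + (n + 1) : ℕ) : ℝ) • W H) := by
        push_cast
        module
      rw [h5]
      exact h4
  refine LinearMap.ext fun H => eq_of_forall_sub_mem fun n => ?_
  exact hamGE_anti (by omega) (key n 0 H (mem_hamGE_zero H))

/-- The part of the logarithmic derivative that is nonlinear in `K` is a contraction for the
filtration by scaling degree. -/
theorem logDeriv_nonlinear_sub_mem {K Q S R : FormalHam} {j : ℕ} (hK : K ∈ hamGE 1)
    (hQ : Q ∈ hamGE 1) (hKQ : K - Q ∈ hamGE j) (hS : HamSum (logDerivTerm K) S)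
    (hR : HamSum (logDerivTerm Q) R) :
    (S - scaling K) - (R - scaling Q) ∈ hamGE (j + 1) := by
  have h := (hS.sub hR).sub_sum_range_mem (M := 2) (m := j + 1) fun n hn => by
    obtain ⟨k, rfl⟩ := Nat.exists_eq_add_of_le' hn
    rw [logDerivTerm, logDerivTerm, ← smul_sub]
    refine Submodule.smul_mem _ _ ?_
    have h1 := ad_pow_sub_mem hKQ (X := scaling K) (Y := scaling Q)
      (by rw [← map_sub]; exact scaling_mem hKQ) k
    rw [pow_succ', pow_succ', Module.End.mul_apply, Module.End.mul_apply, ad_apply, ad_apply,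
      ← sub_add_sub_cancel _ ⁅Q, (ad K ^ k) (scaling K)⁆, ← sub_lie, ← lie_sub]
    refine add_mem (lie_mem_hamGE hKQ ?_ le_rfl) (lie_mem_hamGE hQ h1 (by omega))
    exact hamGE_anti (by omega) (ad_pow_mem_add hK (scaling_mem hK) k)
  rw [sub_sub_sub_comm]
  simpa [Finset.sum_range_succ, logDerivTerm_zero, logDerivTerm_one] using h

/-- Every Hamiltonian of scaling degree at least one is a logarithmic derivative, by the contraction
principle. -/
theorem exists_hamSum_logDerivTerm {y : FormalHam} (hy : y ∈ hamGE 1) :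
    ∃ K ∈ hamGE 1, HamSum (logDerivTerm K) y := by
  have hex : ∀ K : hamGE 1, ∃ K' : hamGE 1, ∃ S, HamSum (logDerivTerm K) S ∧
      scaling K' = y - (S - scaling K) := by
    intro K
    obtain ⟨S, hS⟩ := exists_hamSum (logDerivTerm_mem_self K.2)
    have hS1 : S ∈ hamGE 1 := hS.mem fun n => by
      cases n with
      | zero => exact zero_mem _
      | succ n => exact hamGE_anti (by omega) (logDerivTerm_mem K.2 K.2 n)
    obtain ⟨K', hK', h⟩ := exists_scaling_eq (sub_mem hy (sub_mem hS1 (scaling_mem K.2)))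
    exact ⟨⟨K', hK'⟩, S, hS, h⟩
  choose T S hS hT using hex
  have hcontr : ∀ (K Q : hamGE 1) (j : ℕ), (K - Q : FormalHam) ∈ hamGE j →
      (T K - T Q : FormalHam) ∈ hamGE (j + 1) := by
    intro K Q j h
    refine mem_of_scaling_mem (sub_mem (T K).2 (T Q).2) ?_
    rw [map_sub, hT, hT, sub_sub_sub_cancel_left, ← neg_mem_iff, neg_sub]
    exact logDeriv_nonlinear_sub_mem K.2 Q.2 h (hS K) (hS Q)
  let x : ℕ → hamGE 1 := fun n => T^[n] 0
  have hxs : ∀ n, x (n + 1) = T (x n) := fun n => Function.iterate_succ_apply' T n 0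
  have hx : ∀ n, (x (n + 1) - x n : FormalHam) ∈ hamGE n := by
    intro n
    induction n with
    | zero => exact mem_hamGE_zero _
    | succ n ih =>
      rw [hxs, hxs]
      exact hcontr _ _ _ (by rwa [← hxs])
  obtain ⟨K, hK⟩ := exists_limit (x := fun n => (x n : FormalHam)) hx
  have hK1 : K ∈ hamGE 1 := by simpa using add_mem (hK 1) (x 1).2
  have hfix : K = T ⟨K, hK1⟩ := eq_of_forall_sub_mem fun n => by
    have h1 := hamGE_anti (Nat.le_succ n) (hK (n + 1))
    have h2 := hamGE_anti (Nat.le_succ n) (hcontr ⟨K, hK1⟩ (x n) n (hK n))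
    rw [← hxs] at h2
    simpa using sub_mem h1 h2
  have h := hT ⟨K, hK1⟩
  rw [← hfix] at h
  refine ⟨K, hK1, ?_⟩
  have : S ⟨K, hK1⟩ = y := by
    have h' : scaling K = y - (S ⟨K, hK1⟩ - scaling K) := h
    rw [eq_sub_iff_add_eq, add_sub_cancel] at h'
    exact h'
  exact this ▸ hS ⟨K, hK1⟩

/-- A Hamiltonian is determined by its logarithmic derivative, with control of the scaling degree of
the difference: each use of the contraction property gains one degree. -/
theorem sub_mem_of_logDeriv_sub_mem {K Q S R : FormalHam} {m : ℕ} (hK : K ∈ hamGE 1)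
    (hQ : Q ∈ hamGE 1) (hS : HamSum (logDerivTerm K) S) (hR : HamSum (logDerivTerm Q) R)
    (h : S - R ∈ hamGE m) : K - Q ∈ hamGE m := by
  have key : ∀ j ≤ m, K - Q ∈ hamGE j := by
    intro j
    induction j with
    | zero => exact fun _ => mem_hamGE_zero _
    | succ j ih =>
      intro hj
      refine mem_of_scaling_mem (sub_mem hK hQ) ?_
      have h1 := logDeriv_nonlinear_sub_mem hK hQ (ih (by omega)) hS hR
      have h2 := sub_mem (hamGE_anti hj h) h1
      rw [map_sub]
      convert h2 using 1
      abel
  exact key m le_rfl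

/-- To lowest order the logarithmic derivative is additive. -/
theorem logDeriv_add_sub_mem {F G S f g : FormalHam} {d e : ℕ} (hF : F ∈ hamGE d)
    (hG : G ∈ hamGE e) (hS : HamSum (logDerivTerm (F + G)) S) (hf : HamSum (logDerivTerm F) f)
    (hg : HamSum (logDerivTerm G) g) : S - f - g ∈ hamGE (d + e) := by
  refine ((hS.sub hf).sub hg).mem fun n => ?_
  cases n with
  | zero => simp [logDerivTerm_zero]
  | succ n =>
    rw [logDerivTerm, logDerivTerm, logDerivTerm, ← smul_sub, ← smul_sub]
    refine Submodule.smul_mem _ _ ?_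
    have hpow : ∀ {K : FormalHam} {c : ℕ}, K ∈ hamGE c → ∀ n, (ad K ^ n) (scaling K) ∈ hamGE c := by
      intro K c hK n
      induction n with
      | zero => exact scaling_mem hK
      | succ n ih =>
        rw [pow_succ', Module.End.mul_apply]
        exact lie_mem_hamGE hK ih (by omega)
    induction n with
    | zero => simp
    | succ n ih =>
      simp only [pow_succ', Module.End.mul_apply, ad_apply]
      have h1 : ⁅F + G, (ad (F + G) ^ n) (scaling (F + G)) - (ad F ^ n) (scaling F) -
          (ad G ^ n) (scaling G)⁆ ∈ hamGE (d + e) :=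
        lie_mem_hamGE (mem_hamGE_zero _) ih (by omega)
      have h2 : ⁅F, (ad G ^ n) (scaling G)⁆ ∈ hamGE (d + e) := lie_mem_hamGE hF (hpow hG n) le_rfl
      have h3 : ⁅G, (ad F ^ n) (scaling F)⁆ ∈ hamGE (d + e) :=
        lie_mem_hamGE hG (hpow hF n) (by omega)
      convert add_mem (add_mem h1 h2) h3 using 1
      simp only [lie_sub, add_lie]
      abel

/-! ### Compositions of formal symplectic changes of variables -/

theorem expAd_sub_self_mem_succ (G : hamGE 1) (d : ℕ) (H : FormalHam) (hH : H ∈ hamGE d) :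
    expAd G H - H ∈ hamGE (d + 1) :=
  hamGE_anti (by omega) (expAd_sub_self_mem G G.2 hH)

theorem exists_expAd_mul_eq {F G : hamGE 1} {d e : ℕ} (hF : (F : FormalHam) ∈ hamGE d)
    (hG : (G : FormalHam) ∈ hamGE e) :
    ∃ K : hamGE 1, expAd G * expAd F = expAd K ∧ (K - F - G : FormalHam) ∈ hamGE (d + e) := by
  obtain ⟨f, hf⟩ := exists_hamSum (logDerivTerm_mem_self F.2)
  obtain ⟨g, hg⟩ := exists_hamSum (logDerivTerm_mem_self G.2)
  have hFG : (F + G : FormalHam) ∈ hamGE 1 := add_mem F.2 G.2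
  obtain ⟨R, hR⟩ := exists_hamSum (logDerivTerm_mem_self hFG)
  have hmem : ∀ {c : ℕ} {K y : FormalHam}, K ∈ hamGE 1 → K ∈ hamGE c →
      HamSum (logDerivTerm K) y → y ∈ hamGE c := by
    intro c K y hK hc hy
    refine hy.mem fun n => ?_
    cases n with
    | zero => exact zero_mem _
    | succ n => exact hamGE_anti (by omega) (logDerivTerm_mem hK hc n)
  have hy : g + expAd G f ∈ hamGE 1 :=
    add_mem (hmem G.2 G.2 hg) (expAd_mem G (hmem F.2 F.2 hf))
  obtain ⟨K, hK, hKy⟩ := exists_hamSum_logDerivTerm hy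
  refine ⟨⟨K, hK⟩, ?_, ?_⟩
  · refine HasLogDeriv.unique hy ((hasLogDeriv_expAd hg).expAd_mul (hasLogDeriv_expAd hf))
      (hasLogDeriv_expAd (K := ⟨K, hK⟩) hKy) (fun c H hH => ?_) (expAd_sub_self_mem_succ _)
    have h1 := expAd_sub_self_mem_succ F c H hH
    have h2 := expAd_sub_self_mem_succ G c _ (expAd_mem F hH)
    simpa using add_mem h2 h1
  · have h1 := logDeriv_add_sub_mem hF hG hR hf hg
    have h2 := expAd_sub_self_mem G hG (hmem F.2 hF hf)
    rw [add_comm e d] at h2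
    rw [sub_sub]
    refine sub_mem_of_logDeriv_sub_mem hK hFG hKy hR ?_
    convert sub_mem h2 h1 using 1
    abel

theorem projLE_eq_of_sub_mem {F G : FormalHam} {d : ℕ} (h : F - G ∈ hamGE (d + 1)) :
    projLE d F = projLE d G := by
  ext α β
  change (if _ then coeff F α β else 0) = if _ then coeff G α β else 0
  split_ifs with hd
  · exact sub_eq_zero.1 (h α β (by simp only at hd; omega))
  · rfl

theorem exists_isInfiniteComp {d : ℕ → ℕ} {G : ℕ → hamGE 1} (hd0 : ∀ i, 1 ≤ d i)
    (hd : ∀ i, d i < d (i + 1)) (hG : ∀ i, (G i : FormalHam) ∈ hamGE (d i)) :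
    ∃ K : hamGE 1, (K : FormalHam) ∈ hamGE (d 0) ∧
      IsInfiniteComp (fun i => expAd (G i)) (expAd K) := by
  have hmono : StrictMono d := strictMono_nat_of_lt_succ hd
  have hdn : ∀ n, n + 1 ≤ d n := fun n => by
    have h1 := hmono.add_le_nat n 0
    have h2 := hd0 0
    rw [add_zero] at h1
    omega
  -- combine the factors one after the other
  have hstep : ∀ (n : ℕ) (F : {F : hamGE 1 // (F : FormalHam) ∈ hamGE (d 0)}),
      ∃ K : {F : hamGE 1 // (F : FormalHam) ∈ hamGE (d 0)},
        expAd (G n) * expAd F.1 = expAd K.1 ∧ (K.1 - F.1 : FormalHam) ∈ hamGE (d n) := by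
    intro n F
    obtain ⟨K, hK, hK'⟩ := exists_expAd_mul_eq F.2 (hG n)
    have h1 : (K - F.1 : FormalHam) ∈ hamGE (d n) := by
      simpa using add_mem (hamGE_anti (by omega) hK') (hG n)
    have h2 : (K : FormalHam) ∈ hamGE (d 0) := by
      simpa using add_mem (hamGE_anti (hmono.monotone (Nat.zero_le n)) h1) F.2
    exact ⟨⟨K, h2⟩, hK, h1⟩
  choose T hT hT' using hstep
  let x : ℕ → {F : hamGE 1 // (F : FormalHam) ∈ hamGE (d 0)} :=
    fun n => Nat.rec ⟨0, zero_mem _⟩ T n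
  have hx : ∀ n, partialComp (fun i => expAd (G i)) n = expAd (x n).1 := by
    intro n
    induction n with
    | zero => exact expAd_zero.symm
    | succ n ih =>
      rw [partialComp, ih]
      exact hT n (x n)
  obtain ⟨K, hK⟩ := exists_limit (x := fun n => ((x n).1 : FormalHam)) fun n =>
    hamGE_anti (by have := hdn n; omega) (hT' n (x n))
  have hK0 : K ∈ hamGE (d 0) := by simpa using add_mem (hK (d 0)) (x (d 0)).2
  refine ⟨⟨K, hamGE_anti (hd0 0) hK0⟩, hK0, fun c => ⟨c + 1, fun N hN => ?_⟩⟩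
  rw [hx]
  refine LinearMap.ext fun H => (projLE_eq_of_sub_mem ?_).symm
  exact expAd_sub_expAd_mem (hamGE_anti hN (hK N)) H

/-- The group of formal symplectic changes of variables. -/
def expAdSubgroup : Subgroup (Module.End ℝ FormalHam)ˣ where
  carrier := {u | ∃ G : hamGE 1, expAd G = u}
  one_mem' := ⟨0, expAd_zero⟩
  mul_mem' := by
    rintro u v ⟨G, hG⟩ ⟨F, hF⟩
    obtain ⟨K, hK, -⟩ := exists_expAd_mul_eq F.2 G.2
    exact ⟨K, by rw [← hK, hG, hF, Units.val_mul]⟩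
  inv_mem' := by
    rintro u ⟨G, hG⟩
    refine ⟨-G, ?_⟩
    rw [eq_comm, Units.inv_eq_of_mul_eq_one_right]
    rw [← hG, expAd_mul_expAd_neg]

theorem val_image_expAdSubgroup :
    Units.val '' (expAdSubgroup : Set (Module.End ℝ FormalHam)ˣ) = Set.range expAd := by
  ext E
  constructor
  · rintro ⟨u, ⟨G, hG⟩, rfl⟩
    exact ⟨G, hG⟩
  · rintro ⟨G, rfl⟩
    have h := expAd_mul_expAd_neg (-G)
    rw [neg_neg] at h
    exact ⟨⟨expAd G, expAd (-G), expAd_mul_expAd_neg G, h⟩, ⟨G, rfl⟩, rfl⟩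

end FormalBNF

end

theorem mainTheorem4 :
    -- composition of two formal symplectic changes of variables
    (∀ d₁ d₂ : ℕ, 1 ≤ d₁ → 1 ≤ d₂ → ∀ F G : FormalBNF.hamGE 1,
      (F : FormalBNF.FormalHam) ∈ FormalBNF.hamGE d₁ →
      (G : FormalBNF.FormalHam) ∈ FormalBNF.hamGE d₂ →
      ∃ K : FormalBNF.hamGE 1,
        FormalBNF.expAd G * FormalBNF.expAd F = FormalBNF.expAd K ∧
        (K - F - G : FormalBNF.FormalHam) ∈ FormalBNF.hamGE (d₁ + d₂)) ∧
    -- infinite compositions with strictly increasing orders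
    (∀ (d : ℕ → ℕ) (G : ℕ → FormalBNF.hamGE 1), (∀ i, 1 ≤ d i) → (∀ i, d i < d (i + 1)) →
      (∀ i, (G i : FormalBNF.FormalHam) ∈ FormalBNF.hamGE (d i)) →
      ∃ K : FormalBNF.hamGE 1, (K : FormalBNF.FormalHam) ∈ FormalBNF.hamGE (d 0) ∧
        FormalBNF.IsInfiniteComp (fun i => FormalBNF.expAd (G i)) (FormalBNF.expAd K)) ∧
    -- the formal symplectic changes of variables form a group of invertible operators
    (∃ S : Subgroup (Module.End ℝ FormalBNF.FormalHam)ˣ,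
      Units.val '' (S : Set (Module.End ℝ FormalBNF.FormalHam)ˣ) =
        Set.range FormalBNF.expAd) := by
  refine ⟨fun d₁ d₂ _ _ F G hF hG => FormalBNF.exists_expAd_mul_eq hF hG,
    fun d G hd0 hd hG => FormalBNF.exists_isInfiniteComp hd0 hd hG,
    FormalBNF.expAdSubgroup, FormalBNF.val_image_expAdSubgroup⟩
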